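/- **Conventions.** Graphs are undirected, possibly infinite, without multiple edges; loops are allowed, and $E(G)$ is viewed as a symmetric subset of $V(G)\times V(G)$. For graphs $T,G$ the complex $\mathrm{Hom}(T,G)$ is the polyhedral (CW) complex whose closed cells are the products of simplices $\prod_{x\in V(T)}\Delta^{\eta(x)}$, one for each function $\eta$ from $V(T)$ to the nonempty finite subsets of $V(G)$ such that $|\eta(x)|>1$ for only finitely many $x$, and $\eta(x)\times\eta(y)\subseteq E(G)$ whenever $(x,y)\in E(T)$. A $\mathbb Z_2$-action on $T$ is given by an involutive graph homomorphism $\gamma:T\to T$; it flips an edge if there is $(a,b)\in E(T)$ with $\gamma(a)=b$ and $\gamma(b)=a$. In this case $\gamma$ induces, by $\eta\mapsto\eta\circ\gamma$ on cells, a fixed point free involution of $\mathrm{Hom}(T,G)$ for every graph $G$ without loops. For a CW complex $X$ with a fixed point free involution, choose a $\mathbb Z_2$-map $w:X\to S^\infty$, where $S^\infty$ carries the antipodal action, and let $w/\mathbb Z_2: X/\mathbb Z_2\to\mathbb{RP}^\infty$ be the induced map. The Stiefel–Whitney class of $X$ is $\varpi_1(X)=(w/\mathbb Z_2)^*(z)\in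 H^1(X/\mathbb Z_2;\mathbb Z_2)$, where $z$ is the nontrivial class in $H^1(\mathbb{RP}^\infty;\mathbb Z_2)$; it does not depend on $w$. Let $\varpi_1^k(X)\in H^k(X/\mathbb Z_2;\mathbb Z_2)$ be its $k$-th cup power, with $\varpi_1^0(X)=1$. Let $K_m$ be the complete graph on $m$ vertices without loops, and let $\chi(G)$ be the chromatic number, with $\chi(G)=\infty$ if $G$ has no colouring with finitely many colours. **Theorem.** Let $G$ be a graph without loops, and let $T$ be a graph with a $\mathbb Z_2$-action which flips some edge of $T$. If, for some integers $k\ge 0$ and $m\ge 1$, $$\varpi_1^k(\mathrm{Hom}(T,G))\neq 0\qquad\text{but}\qquad \varpi_1^k(\mathrm{Hom}(T,K_m))=0,$$ then $\chi(G)\ge m+1$. -/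

import Mathlib

noncomputable section

namespace HomSW

/-! ### Singular cohomology with coefficients in `ℤ/2`, and its cup product -/

/-- Singular `n`-simplices of `X`. -/
abbrev SingularSimplex (n : ℕ) (X : Type*) [TopologicalSpace X] : Type _ :=
  C(stdSimplex ℝ (Fin (n + 1)), X)

/-- The affine map of standard simplices which is given by `f` on the vertices. -/
def simplexMap {m n : ℕ} (f : Fin (m + 1) → Fin (n + 1)) :
    C(stdSimplex ℝ (Fin (m + 1)), stdSimplex ℝ (Fin (n + 1))) :=
  ⟨stdSimplex.map f, stdSimplex.continuous_map f⟩

theorem simplexMap_comp {l m n : ℕ} (g : Fin (m + 1) → Fin (n + 1))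
    (f : Fin (l + 1) → Fin (m + 1)) :
    (simplexMap g).comp (simplexMap f) = simplexMap (g ∘ f) := by
  ext1 x
  exact stdSimplex.map_comp_apply f g x

/-- Singular `n`-cochains with coefficients in `ℤ/2`. -/
abbrev Cochain (n : ℕ) (X : Type*) [TopologicalSpace X] : Type _ :=
  SingularSimplex n X → ZMod 2

/-- The coboundary operator: `(d a)(σ) = ∑ i, a (i-th face of σ)` (signs do not matter mod 2). -/
def coboundary (n : ℕ) (X : Type*) [TopologicalSpace X] :
    Cochain n X →ₗ[ZMod 2] Cochain (n + 1) X where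
  toFun a σ := ∑ i : Fin (n + 2), a (σ.comp (simplexMap i.succAbove))
  map_add' a b := by
    funext σ
    simp [Finset.sum_add_distrib]
  map_smul' c a := by
    funext σ
    simp [Finset.mul_sum]

/-- Singular cocycles. -/
def cocycles (n : ℕ) (X : Type*) [TopologicalSpace X] : Submodule (ZMod 2) (Cochain n X) :=
  LinearMap.ker (coboundary n X)

/-- Singular coboundaries; in degree `0` only the zero cochain is one. -/
def coboundaries (n : ℕ) (X : Type*) [TopologicalSpace X] : Submodule (ZMod 2) (Cochain n X) :=
  match n with
  | 0 => ⊥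
  | m + 1 => LinearMap.range (coboundary m X)

/-- The singular cohomology group `Hⁿ(X; ℤ/2)`, cocycles modulo coboundaries. -/
abbrev Cohomology (n : ℕ) (X : Type*) [TopologicalSpace X] : Type _ :=
  (cocycles n X) ⧸ (coboundaries n X).submoduleOf (cocycles n X)

/-- The cohomology class of a cocycle. -/
def cls {n : ℕ} {X : Type*} [TopologicalSpace X] (a : cocycles n X) : Cohomology n X :=
  Submodule.Quotient.mk a

/-- Pullback of cochains along a continuous map. -/
def cochainMap (n : ℕ) {X Y : Type*} [TopologicalSpace X] [TopologicalSpace Y] (f : C(X, Y)) :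
    Cochain n Y →ₗ[ZMod 2] Cochain n X where
  toFun a σ := a (f.comp σ)
  map_add' _ _ := rfl
  map_smul' _ _ := rfl

theorem coboundary_cochainMap (n : ℕ) {X Y : Type*} [TopologicalSpace X] [TopologicalSpace Y]
    (f : C(X, Y)) (a : Cochain n Y) :
    coboundary n X (cochainMap n f a) = cochainMap (n + 1) f (coboundary n Y a) := rfl

theorem cochainMap_mem_cocycles (n : ℕ) {X Y : Type*} [TopologicalSpace X] [TopologicalSpace Y]
    (f : C(X, Y)) (a : Cochain n Y) (ha : a ∈ cocycles n Y) :
    cochainMap n f a ∈ cocycles n X := by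
  have h : coboundary n Y a = 0 := ha
  change coboundary n X (cochainMap n f a) = 0
  rw [coboundary_cochainMap, h, map_zero]

theorem cochainMap_mem_coboundaries (n : ℕ) {X Y : Type*} [TopologicalSpace X]
    [TopologicalSpace Y] (f : C(X, Y)) (a : Cochain n Y) (ha : a ∈ coboundaries n Y) :
    cochainMap n f a ∈ coboundaries n X := by
  cases n with
  | zero =>
    have h : a = 0 := ha
    rw [h, map_zero]
    exact Submodule.zero_mem _
  | succ m =>
    obtain ⟨b, rfl⟩ := ha
    exact ⟨cochainMap m f b, coboundary_cochainMap m f b⟩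

/-- The induced map `f^* : Hⁿ(Y; ℤ/2) → Hⁿ(X; ℤ/2)`. -/
def pullback (n : ℕ) {X Y : Type*} [TopologicalSpace X] [TopologicalSpace Y] (f : C(X, Y)) :
    Cohomology n Y →ₗ[ZMod 2] Cohomology n X :=
  Submodule.mapQ _ _
    ((cochainMap n f).restrict (fun a ha => cochainMap_mem_cocycles n f a ha))
    (fun a ha => cochainMap_mem_coboundaries n f a.1 ha)

/-- Inclusion of the first `p + 1` vertices of an `n`-simplex. -/
def front {p q n : ℕ} (h : p + q = n) (i : Fin (p + 1)) : Fin (n + 1) :=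
  ⟨i.1, by omega⟩

/-- Inclusion of the last `q + 1` vertices of an `n`-simplex. -/
def back {p q n : ℕ} (h : p + q = n) (j : Fin (q + 1)) : Fin (n + 1) :=
  ⟨p + j.1, by omega⟩

/-- The cup product of cochains: front face times back face. -/
def cochainCup {X : Type*} [TopologicalSpace X] {p q n : ℕ} (h : p + q = n)
    (a : Cochain p X) (b : Cochain q X) : Cochain n X :=
  fun σ => a (σ.comp (simplexMap (front h))) * b (σ.comp (simplexMap (back h)))

theorem face_cup {X : Type*} [TopologicalSpace X] {l m n m' : ℕ}
    (σ : SingularSimplex n X) {f : Fin (m + 1) → Fin (n + 1)} {g : Fin (l + 1) → Fin (m + 1)}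
    {f' : Fin (m' + 1) → Fin (n + 1)} {g' : Fin (l + 1) → Fin (m' + 1)}
    (h : ∀ i, (f (g i)).1 = (f' (g' i)).1) :
    (σ.comp (simplexMap f)).comp (simplexMap g) =
      (σ.comp (simplexMap f')).comp (simplexMap g') := by
  rw [ContinuousMap.comp_assoc, ContinuousMap.comp_assoc, simplexMap_comp, simplexMap_comp]
  congr 2
  funext i
  exact Fin.ext (h i)

theorem face_cup' {X : Type*} [TopologicalSpace X] {l m n : ℕ}
    (σ : SingularSimplex n X) {f : Fin (m + 1) → Fin (n + 1)} {g : Fin (l + 1) → Fin (m + 1)}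
    {f' : Fin (l + 1) → Fin (n + 1)} (h : ∀ i, (f (g i)).1 = (f' i).1) :
    (σ.comp (simplexMap f)).comp (simplexMap g) = σ.comp (simplexMap f') := by
  rw [ContinuousMap.comp_assoc, simplexMap_comp]
  congr 2
  funext i
  exact Fin.ext (h i)

theorem succAbove_val {n : ℕ} (i : Fin (n + 1)) (j : Fin n) :
    (i.succAbove j).1 = if j.1 < i.1 then j.1 else j.1 + 1 := by
  unfold Fin.succAbove
  split_ifs <;> simp_all [Fin.lt_def]

/-- The Leibniz rule (mod 2). -/
theorem coboundary_cochainCup {X : Type*} [TopologicalSpace X] {p q n : ℕ} (h : p + q = n)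
    (h₁ : p + 1 + q = n + 1) (h₂ : p + (q + 1) = n + 1) (a : Cochain p X) (b : Cochain q X) :
    coboundary n X (cochainCup h a b) =
      cochainCup h₁ (coboundary p X a) b + cochainCup h₂ a (coboundary q X b) := by
  funext σ
  have hc : (p + 1) + (q + 1) = n + 2 := by omega
  have e₁ : ∀ i : Fin (p + 1),
      a ((σ.comp (simplexMap (Fin.succAbove (Fin.cast hc (Fin.castAdd (q + 1) i))))).comp
          (simplexMap (front h))) *
        b ((σ.comp (simplexMap (Fin.succAbove (Fin.cast hc (Fin.castAdd (q + 1) i))))).comp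
          (simplexMap (back h))) =
      a ((σ.comp (simplexMap (front h₁))).comp (simplexMap i.castSucc.succAbove)) *
        b (σ.comp (simplexMap (back h₁))) := by
    intro i
    congr 2
    · apply face_cup
      intro j
      simp only [succAbove_val, front, Fin.val_cast, Fin.val_castAdd, Fin.val_castSucc]
    · apply face_cup'
      intro j
      have := i.2
      simp only [succAbove_val, back, Fin.val_cast, Fin.val_castAdd]
      split_ifs <;> omega
  have e₂ : ∀ j : Fin (q + 1),
      a ((σ.comp (simplexMap (Fin.succAbove (Fin.cast hc (Fin.natAdd (p + 1) j))))).comp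
          (simplexMap (front h))) *
        b ((σ.comp (simplexMap (Fin.succAbove (Fin.cast hc (Fin.natAdd (p + 1) j))))).comp
          (simplexMap (back h))) =
      a (σ.comp (simplexMap (front h₂))) *
        b ((σ.comp (simplexMap (back h₂))).comp (simplexMap j.succ.succAbove)) := by
    intro j
    congr 2
    · apply face_cup'
      intro i
      have := i.2
      simp only [succAbove_val, front, Fin.val_cast, Fin.val_natAdd]
      split_ifs <;> omega
    · apply face_cup
      intro i
      simp only [succAbove_val, back, Fin.val_cast, Fin.val_natAdd, Fin.val_succ]
      split_ifs <;> omega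
  have e₃ : (σ.comp (simplexMap (front h₁))).comp (simplexMap (Fin.last (p + 1)).succAbove) =
      σ.comp (simplexMap (front h₂)) := by
    apply face_cup'
    intro i
    have := i.2
    simp only [succAbove_val, front, Fin.val_last]
    split_ifs <;> omega
  have e₄ : (σ.comp (simplexMap (back h₂))).comp (simplexMap (0 : Fin (q + 2)).succAbove) =
      σ.comp (simplexMap (back h₁)) := by
    apply face_cup'
    intro i
    simp only [succAbove_val, back, Fin.val_zero, Nat.not_lt_zero, if_false]
    omega
  have key : ∀ u v w : ZMod 2, u + v = u + w + (w + v) := by decide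
  simp only [coboundary, cochainCup, LinearMap.coe_mk, AddHom.coe_mk, Pi.add_apply]
  rw [← Fin.sum_congr' _ hc, Fin.sum_univ_add, Fin.sum_univ_castSucc (n := p + 1),
    Fin.sum_univ_succ (n := q + 1), add_mul, mul_add, Finset.sum_mul, Finset.mul_sum, e₃, e₄,
    Finset.sum_congr rfl (fun i _ => e₁ i), Finset.sum_congr rfl (fun j _ => e₂ j)]
  exact key _ _ _

theorem cochainCup_mem_cocycles {X : Type*} [TopologicalSpace X] {p q n : ℕ} (h : p + q = n)
    {a : Cochain p X} {b : Cochain q X} (ha : a ∈ cocycles p X) (hb : b ∈ cocycles q X) :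
    cochainCup h a b ∈ cocycles n X := by
  have ha' : coboundary p X a = 0 := ha
  have hb' : coboundary q X b = 0 := hb
  change coboundary n X _ = 0
  rw [coboundary_cochainCup h (by omega) (by omega), ha', hb']
  funext σ
  simp [cochainCup]

theorem cochainCup_mem_coboundaries_left {X : Type*} [TopologicalSpace X] {p q n : ℕ}
    (h : p + q = n) {a : Cochain p X} {b : Cochain q X} (ha : a ∈ coboundaries p X)
    (hb : b ∈ cocycles q X) : cochainCup h a b ∈ coboundaries n X := by
  have hb' : coboundary q X b = 0 := hb
  cases p with
  | zero =>
    have h0 : a = 0 := ha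
    have : cochainCup h a b = 0 := by funext σ; simp [cochainCup, h0]
    rw [this]
    exact Submodule.zero_mem _
  | succ p =>
    obtain ⟨c, rfl⟩ := ha
    obtain _ | n := n
    · omega
    refine ⟨cochainCup (p := p) (q := q) (n := n) (by omega) c b, ?_⟩
    rw [coboundary_cochainCup _ h (by omega), hb']
    funext σ
    simp [cochainCup]

theorem cochainCup_mem_coboundaries_right {X : Type*} [TopologicalSpace X] {p q n : ℕ}
    (h : p + q = n) {a : Cochain p X} {b : Cochain q X} (ha : a ∈ cocycles p X)
    (hb : b ∈ coboundaries q X) : cochainCup h a b ∈ coboundaries n X := by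
  have ha' : coboundary p X a = 0 := ha
  cases q with
  | zero =>
    have h0 : b = 0 := hb
    have : cochainCup h a b = 0 := by funext σ; simp [cochainCup, h0]
    rw [this]
    exact Submodule.zero_mem _
  | succ q =>
    obtain ⟨c, rfl⟩ := hb
    obtain _ | n := n
    · omega
    refine ⟨cochainCup (p := p) (q := q) (n := n) (by omega) a c, ?_⟩
    rw [coboundary_cochainCup _ (by omega) h, ha']
    funext σ
    simp [cochainCup]

/-- The cup product `Hᵖ × H^q → Hⁿ`, `n = p + q`. -/
def cup {X : Type*} [TopologicalSpace X] {p q n : ℕ} (h : p + q = n)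
    (a : Cohomology p X) (b : Cohomology q X) : Cohomology n X :=
  Quotient.map₂
    (fun (a : cocycles p X) (b : cocycles q X) =>
      (⟨cochainCup h a.1 b.1, cochainCup_mem_cocycles h a.2 b.2⟩ : cocycles n X))
    (by
      intro a a' haa b b' hbb
      have h₁ : a.1 - a'.1 ∈ coboundaries p X :=
        (Submodule.quotientRel_def ((coboundaries p X).submoduleOf (cocycles p X))).1 haa
      have h₂ : b.1 - b'.1 ∈ coboundaries q X :=
        (Submodule.quotientRel_def ((coboundaries q X).submoduleOf (cocycles q X))).1 hbb
      refine (Submodule.quotientRel_def ((coboundaries n X).submoduleOf (cocycles n X))).2 ?_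
      change cochainCup h a.1 b.1 - cochainCup h a'.1 b'.1 ∈ coboundaries n X
      have e : cochainCup h a.1 b.1 - cochainCup h a'.1 b'.1 =
          cochainCup h (a.1 - a'.1) b.1 + cochainCup h a'.1 (b.1 - b'.1) := by
        funext σ
        simp only [cochainCup, Pi.sub_apply, Pi.add_apply]
        ring
      rw [e]
      exact Submodule.add_mem _ (cochainCup_mem_coboundaries_left h h₁ b.2)
        (cochainCup_mem_coboundaries_right h a'.2 h₂)) a b

/-- The unit `1 ∈ H⁰(X; ℤ/2)`, the class of the constant cochain `1`. -/
def unitClass (X : Type*) [TopologicalSpace X] : Cohomology 0 X :=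
  cls ⟨fun _ => 1, by
    change coboundary 0 X _ = 0
    funext σ
    simp only [coboundary, LinearMap.coe_mk, AddHom.coe_mk, Pi.zero_apply]
    decide⟩

/-- The `k`-th cup power of a class of degree one. -/
def cupPow {X : Type*} [TopologicalSpace X] (a : Cohomology 1 X) : (k : ℕ) → Cohomology k X
  | 0 => unitClass X
  | k + 1 => cup rfl (cupPow a k) a

/-! ### Free involutions, the infinite sphere, and the Stiefel-Whitney class -/

/-- A fixed point free continuous involution of `X`, that is, a free action of `ℤ₂` on `X`. -/
structure FreeInvolution (X : Type*) [TopologicalSpace X] where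
  toMap : C(X, X)
  involutive : ∀ x, toMap (toMap x) = x
  free : ∀ x, toMap x ≠ x

/-- The orbit space `X / ℤ₂` with the quotient topology. -/
abbrev OrbitSpace {X : Type*} [TopologicalSpace X] (τ : FreeInvolution X) : Type _ :=
  Quot (fun x y : X => τ.toMap x = y)

/-- A `ℤ₂`-map: a continuous equivariant map. -/
structure EquivariantMap {X Y : Type*} [TopologicalSpace X] [TopologicalSpace Y]
    (τ : FreeInvolution X) (ρ : FreeInvolution Y) where
  toMap : C(X, Y)
  equivariant : ∀ x, toMap (τ.toMap x) = ρ.toMap (toMap x)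

/-- The map of orbit spaces which a `ℤ₂`-map induces. -/
def EquivariantMap.onOrbits {X Y : Type*} [TopologicalSpace X] [TopologicalSpace Y]
    {τ : FreeInvolution X} {ρ : FreeInvolution Y} (f : EquivariantMap τ ρ) :
    C(OrbitSpace τ, OrbitSpace ρ) where
  toFun := Quot.map f.toMap (fun x y h => by rw [← h, f.equivariant])
  continuous_toFun :=
    continuous_quot_lift _ (continuous_quot_mk.comp f.toMap.continuous)

/-- The unit sphere of `ℝⁿ`, for `ℝⁿ` the sequences that vanish from index `n` on. -/
def finSphere (n : ℕ) : Set (ℕ → ℝ) :=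
  {v | (∀ i, n ≤ i → v i = 0) ∧ ∑ i ∈ Finset.range n, v i ^ 2 = 1}

/-- The infinite-dimensional sphere `S^∞`, the union of the finite-dimensional spheres. -/
def InfSphere : Type := {v : ℕ → ℝ // ∃ n, v ∈ finSphere n}

/-- Inclusion of a finite-dimensional sphere into `S^∞`. -/
def InfSphere.incl (n : ℕ) (v : finSphere n) : InfSphere := ⟨v.1, n, v.2⟩

/-- The colimit (weak) topology: a set is open iff its trace on each finite-dimensional sphere
is open. -/
instance InfSphere.instTopologicalSpace : TopologicalSpace InfSphere :=
  ⨆ n : ℕ, TopologicalSpace.coinduced (InfSphere.incl n) inferInstance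

theorem InfSphere.continuous_incl (n : ℕ) : Continuous (InfSphere.incl n) :=
  continuous_iff_coinduced_le.2
    (le_iSup (fun n : ℕ => TopologicalSpace.coinduced (InfSphere.incl n) inferInstance) n)

theorem finSphere_neg {n : ℕ} {v : ℕ → ℝ} (hv : v ∈ finSphere n) : -v ∈ finSphere n :=
  ⟨fun i hi => by simp [hv.1 i hi], by simpa using hv.2⟩

/-- The antipodal involution of `S^∞`. -/
def antipodal : FreeInvolution InfSphere where
  toMap :=
    { toFun := fun v => ⟨-v.1, v.2.imp fun _ h => finSphere_neg h⟩
      continuous_toFun := by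
        refine continuous_iSup_dom.2 fun n => continuous_coinduced_dom.2 ?_
        exact (InfSphere.continuous_incl n).comp
          (f := fun v : finSphere n => (⟨-v.1, finSphere_neg v.2⟩ : finSphere n))
          (continuous_subtype_val.neg.subtype_mk _) }
  involutive v := Subtype.ext (neg_neg v.1)
  free v h := by
    obtain ⟨v, n, hv⟩ := v
    have h₀ : -v = v := congrArg Subtype.val h
    have h₁ : ∀ i, v i = 0 := fun i => by
      have := congrFun h₀ i
      simp only [Pi.neg_apply] at this
      linarith
    have h₂ := hv.2
    simp [h₁] at h₂

/-- The nontrivial class `z ∈ H¹(ℝP^∞; ℤ/2)`, where `ℝP^∞ = S^∞ / ℤ₂`; this cohomology group has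
exactly one nonzero element. -/
def generatorRP : Cohomology 1 (OrbitSpace antipodal) :=
  Classical.epsilon (fun z => z ≠ 0)

open Classical in
/-- The Stiefel-Whitney class `ϖ₁(X) = (w/ℤ₂)^*(z) ∈ H¹(X/ℤ₂; ℤ/2)` of a space `X` with a free
involution, where `w : X → S^∞` is a `ℤ₂`-map. Such a map exists, and the class does not depend on
it, whenever `X` is a CW complex; where there is none the value is `0` by convention. -/
def stiefelWhitney {X : Type*} [TopologicalSpace X] (τ : FreeInvolution X) :
    Cohomology 1 (OrbitSpace τ) :=
  if h : Nonempty (EquivariantMap τ antipodal) then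
    pullback 1 (Classical.choice h).onOrbits generatorRP
  else 0

/-! ### Graphs and the complexes `Hom(T, G)` -/

/-- Undirected graphs without multiple edges; loops are allowed. -/
structure LoopGraph (V : Type*) where
  Adj : V → V → Prop
  symm : ∀ x y, Adj x y → Adj y x

/-- A graph without loops, as a graph. -/
def LoopGraph.ofSimple {W : Type*} (G : SimpleGraph W) : LoopGraph W where
  Adj := G.Adj
  symm _ _ h := h.symm

/-- An action of `ℤ₂` on a graph: an involutive graph homomorphism of the graph to itself (the
action of the nontrivial element of `ℤ₂`). -/
structure LoopGraph.Z2Action {V : Type*} (T : LoopGraph V) where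
  toFun : V → V
  involutive : ∀ x, toFun (toFun x) = x
  map_adj : ∀ x y, T.Adj x y → T.Adj (toFun x) (toFun y)

/-- The action flips some edge: it interchanges its two ends. -/
def LoopGraph.Z2Action.FlipsEdge {V : Type*} {T : LoopGraph V} (γ : T.Z2Action) : Prop :=
  ∃ a b, T.Adj a b ∧ γ.toFun a = b ∧ γ.toFun b = a

/-- The cells of `Hom(T, G)`: functions `η` from `V(T)` to the nonempty finite subsets of `V(G)`,
all but finitely many values of which are singletons, such that `η x × η y ⊆ E(G)` for each edge
`(x, y)` of `T`. -/
structure HomCell {V W : Type*} (T : LoopGraph V) (G : LoopGraph W) where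
  toFun : V → Finset W
  nonempty : ∀ x, (toFun x).Nonempty
  finite : {x | 1 < (toFun x).card}.Finite
  adj : ∀ x y, T.Adj x y → ∀ u ∈ toFun x, ∀ v ∈ toFun y, G.Adj u v

/-- The closed geometric cell `∏ x, Δ^{η x}`: all families `(p x)` of convex combinations `p x` of
the elements of `η x`. -/
def HomCell.carrier {V W : Type*} {T : LoopGraph V} {G : LoopGraph W} (η : HomCell T G) :
    Set (V → W → ℝ) :=
  {p | ∀ x, (∀ w, 0 ≤ p x w) ∧ (∀ w, w ∉ η.toFun x → p x w = 0) ∧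
    ∑ w ∈ η.toFun x, p x w = 1}

/-- The polyhedral complex `Hom(T, G)`, the union of its closed cells. -/
def HomComplex {V W : Type*} (T : LoopGraph V) (G : LoopGraph W) : Type _ :=
  {p : V → W → ℝ // ∃ η : HomCell T G, p ∈ η.carrier}

/-- Inclusion of a closed cell. -/
def HomComplex.incl {V W : Type*} {T : LoopGraph V} {G : LoopGraph W} (η : HomCell T G)
    (p : η.carrier) : HomComplex T G := ⟨p.1, η, p.2⟩

/-- The topology of a CW complex: a set is open iff its trace on each closed cell (a product of
simplices, with the product topology) is open. -/
instance HomComplex.instTopologicalSpace {V W : Type*} (T : LoopGraph V) (G : LoopGraph W) :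
    TopologicalSpace (HomComplex T G) :=
  ⨆ η : HomCell T G, TopologicalSpace.coinduced (HomComplex.incl η) inferInstance

theorem HomComplex.continuous_incl {V W : Type*} {T : LoopGraph V} {G : LoopGraph W}
    (η : HomCell T G) : Continuous (HomComplex.incl η) :=
  continuous_iff_coinduced_le.2
    (le_iSup (fun η : HomCell T G =>
      TopologicalSpace.coinduced (HomComplex.incl η) inferInstance) η)

/-- The action on cells, `η ↦ η ∘ γ`. -/
def HomCell.act {V W : Type*} {T : LoopGraph V} {G : LoopGraph W} (γ : T.Z2Action)
    (η : HomCell T G) : HomCell T G where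
  toFun x := η.toFun (γ.toFun x)
  nonempty _ := η.nonempty _
  finite := Set.Finite.preimage (f := γ.toFun)
    (Function.LeftInverse.injective γ.involutive).injOn η.finite
  adj x y h := η.adj _ _ (γ.map_adj x y h)

theorem HomCell.act_carrier {V W : Type*} {T : LoopGraph V} {G : LoopGraph W} (γ : T.Z2Action)
    {η : HomCell T G} {p : V → W → ℝ} (hp : p ∈ η.carrier) :
    (fun x => p (γ.toFun x)) ∈ (η.act γ).carrier :=
  fun x => hp (γ.toFun x)

/-- The `ℤ₂`-space `Hom(T, G)` for a graph `G` without loops and a graph `T` with a `ℤ₂`-action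
that flips an edge: the involution is `p ↦ p ∘ γ`. -/
def homInvolution {V W : Type*} {T : LoopGraph V} (γ : T.Z2Action) (hγ : γ.FlipsEdge)
    (G : SimpleGraph W) : FreeInvolution (HomComplex T (LoopGraph.ofSimple G)) where
  toMap :=
    { toFun := fun p =>
        ⟨fun x => p.1 (γ.toFun x), p.2.elim fun η h => ⟨η.act γ, HomCell.act_carrier γ h⟩⟩
      continuous_toFun := by
        refine continuous_iSup_dom.2 fun η => continuous_coinduced_dom.2 ?_
        exact (HomComplex.continuous_incl (η.act γ)).comp
          (f := fun p : η.carrier =>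
            (⟨fun x => p.1 (γ.toFun x), HomCell.act_carrier γ p.2⟩ : (η.act γ).carrier))
          (Continuous.subtype_mk (continuous_pi fun x =>
            (continuous_apply (γ.toFun x)).comp
              (continuous_subtype_val : Continuous fun p : η.carrier => p.1)) _) }
  involutive p := Subtype.ext (funext fun x => congrArg p.1 (γ.involutive x))
  free p h := by
    obtain ⟨a, b, hab, rfl, -⟩ := hγ
    obtain ⟨p, η, hp⟩ := p
    have h₀ : p (γ.toFun a) = p a := congrFun (congrArg Subtype.val h) a
    obtain ⟨w, hw, hne⟩ : ∃ w ∈ η.toFun a, p a w ≠ 0 := by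
      apply Finset.exists_ne_zero_of_sum_ne_zero
      rw [(hp a).2.2]
      exact one_ne_zero
    have hw' : w ∈ η.toFun (γ.toFun a) := by
      by_contra hn
      exact hne (by rw [← h₀]; exact (hp (γ.toFun a)).2.1 w hn)
    exact G.irrefl (η.adj _ _ hab w hw w hw')

end HomSW

end

noncomputable section

namespace HomSW

/-! ### Functoriality of the cup product and homotopy invariance in degree one -/

/-! If `G` had an `m`-colouring `c : G → K_m`, pushing weights forward along `c` would give a
`ℤ₂`-map `f : Hom(T, G) → Hom(T, K_m)`. For a `ℤ₂`-map `w : Hom(T, K_m) → S^∞`, the composite `w ∘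
f` is a `ℤ₂`-map on `Hom(T, G)`. Hence `ϖ₁(Hom(T, G)) = f^* ϖ₁(Hom(T, K_m))`, and naturality of the
cup product makes the `k`-th power on the left the pullback of zero.

Two facts carry this. Existence of `w` is needed only for a finite target graph, where the
difference of weights at the ends of a flipped edge provides it
(`nonempty_equivariantMap_antipodal`). Independence of `w` (`pullback_onOrbits_unique`) is needed
because the definition of the class makes an arbitrary choice. Any two `ℤ₂`-maps to `S^∞` are joined
by three equivariant homotopies along great circle arcs, and homotopy invariance in degree one
suffices, since higher powers follow by naturality. The argument uses no property of the class
`generatorRP`. -/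

theorem pullback_comp (n : ℕ) {X Y Z : Type*} [TopologicalSpace X] [TopologicalSpace Y]
    [TopologicalSpace Z] (g : C(Y, Z)) (f : C(X, Y)) (z : Cohomology n Z) :
    pullback n f (pullback n g z) = pullback n (g.comp f) z := by
  induction z using Submodule.Quotient.induction_on with
  | H z => rfl

theorem pullback_cup {X Y : Type*} [TopologicalSpace X] [TopologicalSpace Y] (f : C(X, Y))
    {p q n : ℕ} (h : p + q = n) (a : Cohomology p Y) (b : Cohomology q Y) :
    pullback n f (cup h a b) = cup h (pullback p f a) (pullback q f b) := by
  induction a using Submodule.Quotient.induction_on with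
  | H a =>
    induction b using Submodule.Quotient.induction_on with
    | H b => rfl

theorem pullback_cupPow {X Y : Type*} [TopologicalSpace X] [TopologicalSpace Y] (f : C(X, Y))
    (a : Cohomology 1 Y) (k : ℕ) : pullback k f (cupPow a k) = cupPow (pullback 1 f a) k := by
  induction k with
  | zero => rfl
  | succ k ih => rw [cupPow, pullback_cup, ih, cupPow]

/-! ### Prism decomposition and homotopy invariance of `H¹`. -/

theorem simplexMap_id (n : ℕ) : simplexMap (id : Fin (n + 1) → Fin (n + 1)) = .id _ := by
  ext1 x
  exact stdSimplex.map_id_apply x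

/-- A constant vertex map factors through the `0`-simplex, which is a single point. -/
theorem simplexMap_const {m n : ℕ} (j : Fin (n + 1)) (x : stdSimplex ℝ (Fin (m + 1))) :
    simplexMap (fun _ => j) x = stdSimplex.vertex j := by
  have h : (fun _ : Fin (m + 1) => j) = (fun _ : Fin 1 => j) ∘ fun _ => 0 := rfl
  rw [h, ← simplexMap_comp]
  change stdSimplex.map _ (stdSimplex.map _ x) = _
  rw [Subsingleton.elim (stdSimplex.map (fun _ => (0 : Fin 1)) x) (stdSimplex.vertex 0),
    stdSimplex.map_vertex]

/-- The singular simplex `s ↦ H (σ (f s), g s)` for a homotopy `H` parametrized by the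
`1`-simplex. -/
def prism {Y Z : Type*} [TopologicalSpace Y] [TopologicalSpace Z]
    (H : C(Y × stdSimplex ℝ (Fin 2), Z)) {m n : ℕ} (f : Fin (m + 1) → Fin (n + 1))
    (g : Fin (m + 1) → Fin 2) (σ : SingularSimplex n Y) : SingularSimplex m Z :=
  H.comp ((σ.comp (simplexMap f)).prodMk (simplexMap (n := 1) g))

theorem prism_face {Y Z : Type*} [TopologicalSpace Y] [TopologicalSpace Z]
    (H : C(Y × stdSimplex ℝ (Fin 2), Z)) {l m n : ℕ} (f : Fin (m + 1) → Fin (n + 1))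
    (g : Fin (m + 1) → Fin 2) (e : Fin (l + 1) → Fin (m + 1)) (σ : SingularSimplex n Y) :
    (prism H f g σ).comp (simplexMap e) = prism H (f ∘ e) (g ∘ e) σ := by
  unfold prism
  rw [← simplexMap_comp, ← simplexMap_comp]
  rfl

theorem prism_comp {Y Z : Type*} [TopologicalSpace Y] [TopologicalSpace Z]
    (H : C(Y × stdSimplex ℝ (Fin 2), Z)) {l m n : ℕ} (f : Fin (m + 1) → Fin (n + 1))
    (g : Fin (m + 1) → Fin 2) (e : Fin (n + 1) → Fin (l + 1)) (σ : SingularSimplex l Y) :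
    prism H f g (σ.comp (simplexMap e)) = prism H (e ∘ f) g σ := by
  unfold prism
  rw [← simplexMap_comp]
  rfl

theorem prism_const {Y Z : Type*} [TopologicalSpace Y] [TopologicalSpace Z]
    (H : C(Y × stdSimplex ℝ (Fin 2), Z)) {n : ℕ} (j : Fin 2) (f : C(Y, Z))
    (h : ∀ y, H (y, stdSimplex.vertex j) = f y) (σ : SingularSimplex n Y) :
    prism H id (fun _ => j) σ = f.comp σ := by
  ext1 x
  change H (σ (simplexMap id x), simplexMap (n := 1) (fun _ => j) x) = f (σ x)
  rw [simplexMap_const, simplexMap_id, h]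
  rfl

/-- Homotopic maps induce the same map on `H¹`. -/
theorem pullback_one_eq_of_homotopy {Y Z : Type*} [TopologicalSpace Y] [TopologicalSpace Z]
    (H : C(Y × stdSimplex ℝ (Fin 2), Z)) (f₀ f₁ : C(Y, Z))
    (h₀ : ∀ y, H (y, stdSimplex.vertex 0) = f₀ y) (h₁ : ∀ y, H (y, stdSimplex.vertex 1) = f₁ y)
    (z : Cohomology 1 Z) : pullback 1 f₀ z = pullback 1 f₁ z := by
  induction z using Submodule.Quotient.induction_on with
  | H c =>
    refine (Submodule.Quotient.eq _).2 ?_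
    change cochainMap 1 f₀ c.1 - cochainMap 1 f₁ c.1 ∈ coboundaries 1 Y
    -- The bounding `0`-cochain evaluates `c` on the path that a point traces under the homotopy.
    refine ⟨fun τ => c.1 (prism H (fun _ => 0) id τ), ?_⟩
    funext σ
    have hc : ∀ s : SingularSimplex 2 Z,
        ∑ i : Fin 3, c.1 (s.comp (simplexMap i.succAbove)) = 0 :=
      congrFun (show coboundary 1 Z c.1 = 0 from c.2)
    -- The square (path parameter, homotopy parameter) is cut along its diagonal into triangles with
    -- vertices (0,0), (1,0), (1,1) and (0,0), (0,1), (1,1). The cocycle condition holds on both,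
    -- and the shared diagonal, face 1 of each, cancels when they are added.
    have hA := (Fin.sum_univ_three _).symm.trans (hc (prism H ![0, 1, 1] ![0, 0, 1] σ))
    have hB := (Fin.sum_univ_three _).symm.trans (hc (prism H ![0, 0, 1] ![0, 1, 1] σ))
    simp only [prism_face] at hA hB
    change ∑ i : Fin 2, c.1 (prism H (fun _ => 0) id (σ.comp (simplexMap i.succAbove))) =
      c.1 (f₀.comp σ) - c.1 (f₁.comp σ)
    rw [Fin.sum_univ_two]
    simp only [prism_comp, ← prism_const H 0 f₀ h₀, ← prism_const H 1 f₁ h₁]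
    have a₀ : (![0, 1, 1] : Fin 3 → Fin 2) ∘ Fin.succAbove 0 = fun _ => 1 := by decide
    have a₁ : (![0, 1, 1] : Fin 3 → Fin 2) ∘ Fin.succAbove 1 = id := by decide
    have a₂ : (![0, 1, 1] : Fin 3 → Fin 2) ∘ Fin.succAbove 2 = id := by decide
    have b₀ : (![0, 0, 1] : Fin 3 → Fin 2) ∘ Fin.succAbove 0 = id := by decide
    have b₁ : (![0, 0, 1] : Fin 3 → Fin 2) ∘ Fin.succAbove 1 = id := by decide
    have b₂ : (![0, 0, 1] : Fin 3 → Fin 2) ∘ Fin.succAbove 2 = fun _ => 0 := by decide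
    have c₀ : Fin.succAbove (0 : Fin 2) ∘ (fun _ : Fin 2 => (0 : Fin 1)) = fun _ => 1 := by decide
    have c₁ : Fin.succAbove (1 : Fin 2) ∘ (fun _ : Fin 2 => (0 : Fin 1)) = fun _ => 0 := by decide
    rw [a₀, a₁, a₂, b₀, b₁, b₂] at hA hB
    erw [c₀, c₁]
    have key : ∀ p q r s t : ZMod 2, p + q + r = 0 → s + q + t = 0 → p + t = r - s := by decide
    exact key _ _ _ _ _ hA hB

/-- An equivariant homotopy between two `ℤ₂`-maps makes them agree on `H¹` of the orbit spaces. -/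
theorem pullback_onOrbits_eq {X Y : Type*} [TopologicalSpace X] [TopologicalSpace Y]
    {τ : FreeInvolution X} {ρ : FreeInvolution Y} (w w' : EquivariantMap τ ρ)
    (H : C(X, C(stdSimplex ℝ (Fin 2), Y)))
    (hH : ∀ x t, H (τ.toMap x) t = ρ.toMap (H x t))
    (h₀ : ∀ x, H x (stdSimplex.vertex 0) = w.toMap x)
    (h₁ : ∀ x, H x (stdSimplex.vertex 1) = w'.toMap x) (z : Cohomology 1 (OrbitSpace ρ)) :
    pullback 1 w.onOrbits z = pullback 1 w'.onOrbits z := by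
  let q : C(Y, OrbitSpace ρ) := ⟨Quot.mk _, continuous_quot_mk⟩
  have hq : ∀ x y, τ.toMap x = y → q.comp (H x) = q.comp (H y) := by
    rintro x _ rfl
    ext1 t
    exact Quot.sound (hH x t).symm
  -- In curried form the homotopy descends by the universal property of the quotient `X / ℤ₂` alone;
  -- uncurrying is then possible because the `1`-simplex is compact.
  let K : C(OrbitSpace τ, C(stdSimplex ℝ (Fin 2), OrbitSpace ρ)) :=
    ⟨Quot.lift (fun x => q.comp (H x)) hq,
      continuous_quot_lift _ ((ContinuousMap.continuous_postcomp q).comp H.continuous)⟩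
  refine pullback_one_eq_of_homotopy K.uncurry _ _ ?_ ?_ z
  · rintro ⟨x⟩
    exact congrArg q (h₀ x)
  · rintro ⟨x⟩
    exact congrArg q (h₁ x)

/-! ### The infinite sphere -/

theorem InfSphere.continuous_coord (i : ℕ) : Continuous fun v : InfSphere => v.1 i :=
  continuous_iSup_dom.2 fun _ => continuous_coinduced_dom.2
    ((continuous_apply i).comp continuous_subtype_val)

theorem InfSphere.finite_support (v : InfSphere) : v.1.support.Finite := by
  obtain ⟨v, n, hv⟩ := v
  refine (Set.finite_lt_nat n).subset fun i hi => ?_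
  by_contra h
  exact hi (hv.1 i (not_lt.1 h))

theorem InfSphere.ne_zero (v : InfSphere) : v.1 ≠ 0 := by
  obtain ⟨v, n, hv⟩ := v
  rintro rfl
  simpa using hv.2

/-- `finsum` expresses the squared norm without naming a finite-dimensional sphere that contains the
point. -/
theorem finsum_sq_eq {n : ℕ} {v : ℕ → ℝ} (h : ∀ i, n ≤ i → v i = 0) :
    ∑ᶠ i, v i ^ 2 = ∑ i ∈ Finset.range n, v i ^ 2 := by
  refine finsum_eq_sum_of_support_subset _ fun i hi => ?_
  rw [Finset.coe_range, Set.mem_Iio]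
  by_contra hn
  exact hi (by simp [h i (not_lt.1 hn)])

theorem InfSphere.finsum_sq (v : InfSphere) : ∑ᶠ i, v.1 i ^ 2 = 1 := by
  obtain ⟨v, n, hv⟩ := v
  exact (finsum_sq_eq hv.1).trans hv.2

theorem exists_bound_of_finite_support {v : ℕ → ℝ} (h : v.support.Finite) :
    ∃ n, ∀ i, n ≤ i → v i = 0 := by
  obtain ⟨n, hn⟩ := h.bddAbove
  refine ⟨n + 1, fun i hi => ?_⟩
  by_contra hne
  have := hn hne
  omega

theorem finsum_sq_pos {v : ℕ → ℝ} (hf : v.support.Finite) (h0 : v ≠ 0) :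
    0 < ∑ᶠ i, v i ^ 2 := by
  obtain ⟨n, hn⟩ := exists_bound_of_finite_support hf
  obtain ⟨i, hi⟩ := Function.ne_iff.1 h0
  rw [finsum_sq_eq hn]
  refine Finset.sum_pos' (fun _ _ => sq_nonneg _) ⟨i, Finset.mem_range.2 ?_, by
    have : v i ≠ 0 := hi
    positivity⟩
  by_contra hni
  exact hi (hn i (not_lt.1 hni))

theorem div_sqrt_mem_finSphere {n : ℕ} {v : ℕ → ℝ} (hn : ∀ i, n ≤ i → v i = 0) (h0 : v ≠ 0) :
    (fun i => v i / √(∑ᶠ j, v j ^ 2)) ∈ finSphere n := by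
  have hf : v.support.Finite := (Set.finite_lt_nat n).subset fun i hi => by
    by_contra h
    exact hi (hn i (not_lt.1 h))
  have hp := finsum_sq_pos hf h0
  refine ⟨fun i hi => by simp [hn i hi], ?_⟩
  simp only [div_pow, Real.sq_sqrt hp.le]
  rw [← Finset.sum_div, ← finsum_sq_eq hn, div_self hp.ne']

/-- Radial projection of the nonzero finitely supported sequences to `S^∞`. -/
def InfSphere.normalize (v : ℕ → ℝ) (hf : v.support.Finite) (h0 : v ≠ 0) : InfSphere :=
  ⟨fun i => v i / √(∑ᶠ j, v j ^ 2),
    (exists_bound_of_finite_support hf).imp fun _ hn => div_sqrt_mem_finSphere hn h0⟩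

theorem InfSphere.normalize_eq {v : ℕ → ℝ} (hf : v.support.Finite) (h0 : v ≠ 0) (u : InfSphere)
    (h : v = u.1) : InfSphere.normalize v hf h0 = u := by
  subst h
  refine Subtype.ext (funext fun i => ?_)
  change u.1 i / √(∑ᶠ j, u.1 j ^ 2) = _
  rw [u.finsum_sq, Real.sqrt_one, div_one]

theorem InfSphere.normalize_neg {u v : ℕ → ℝ} (hu : u.support.Finite) (hu0 : u ≠ 0)
    (hv : v.support.Finite) (hv0 : v ≠ 0) (h : u = -v) :
    InfSphere.normalize u hu hu0 = antipodal.toMap (InfSphere.normalize v hv hv0) := by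
  subst h
  refine Subtype.ext (funext fun i => ?_)
  change (-v) i / √(∑ᶠ j, (-v) j ^ 2) = -(v i / √(∑ᶠ j, v j ^ 2))
  simp only [Pi.neg_apply, neg_sq, neg_div]

/-- A family of nonzero vectors of `ℝⁿ` that depends continuously on a parameter gives a
continuous map to `S^∞`. -/
theorem InfSphere.continuous_normalize {K : Type*} [TopologicalSpace K] (n : ℕ) (φ : K → ℕ → ℝ)
    (hc : ∀ i, Continuous fun k => φ k i) (hn : ∀ k i, n ≤ i → φ k i = 0)
    (hf : ∀ k, (φ k).support.Finite) (h0 : ∀ k, φ k ≠ 0) :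
    Continuous fun k => InfSphere.normalize (φ k) (hf k) (h0 k) := by
  refine (InfSphere.continuous_incl n).comp (f := fun k =>
    (⟨_, div_sqrt_mem_finSphere (hn k) (h0 k)⟩ : finSphere n)) ?_
  refine Continuous.subtype_mk (continuous_pi fun i => (hc i).div ?_ fun k =>
    (Real.sqrt_pos.2 (finsum_sq_pos (hf k) (h0 k))).ne') _
  simp only [fun k => finsum_sq_eq (hn k)]
  exact Real.continuous_sqrt.comp (continuous_finsetSum _ fun j _ => (hc j).pow 2)

/-- A compact subset of `S^∞` lies in a finite-dimensional sphere. -/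
theorem InfSphere.exists_bound_of_compact {K : Type*} [TopologicalSpace K] [CompactSpace K]
    (f : K → InfSphere) (hf : Continuous f) : ∃ n, ∀ k i, n ≤ i → (f k).1 i = 0 := by
  classical
  -- The weights make `F`, a weighted `ℓ¹` norm, at least `i` at some point of the image whenever
  -- coordinate `i` is not identically zero there. `F` is a finite sum on each finite-dimensional
  -- sphere, hence continuous for the weak topology, and so bounded on the compact image.
  let a : ℕ → ℝ := fun i =>
    if h : ∃ k, (f k).1 i ≠ 0 then i / |(f h.choose).1 i| else 0
  have ha : ∀ i, 0 ≤ a i := fun i => by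
    simp only [a]
    split_ifs <;> positivity
  let F : InfSphere → ℝ := fun v => ∑ᶠ i, a i * |v.1 i|
  have hF : ∀ v : InfSphere, ∀ n, (∀ i, n ≤ i → v.1 i = 0) →
      F v = ∑ i ∈ Finset.range n, a i * |v.1 i| := fun v n hv =>
    finsum_eq_sum_of_support_subset _ fun i hi => by
      rw [Finset.coe_range, Set.mem_Iio]
      by_contra hn
      exact hi (by simp [hv i (not_lt.1 hn)])
  have hFc : Continuous F := continuous_iSup_dom.2 fun n => continuous_coinduced_dom.2 <| by
    have : F ∘ InfSphere.incl n = fun v => ∑ i ∈ Finset.range n, a i * |v.1 i| :=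
      funext fun v => hF (InfSphere.incl n v) n v.2.1
    rw [this]
    exact continuous_finsetSum _ fun i _ => continuous_const.mul
      ((continuous_apply i).comp continuous_subtype_val).abs
  obtain ⟨B, hB⟩ := (isCompact_range (hFc.comp hf)).bddAbove
  obtain ⟨N, hN⟩ := exists_nat_gt B
  refine ⟨N, fun k i hi => ?_⟩
  by_contra hne
  have hex : ∃ k, (f k).1 i ≠ 0 := ⟨k, hne⟩
  obtain ⟨n, hn⟩ := exists_bound_of_finite_support (f hex.choose).finite_support
  have hin : i ∈ Finset.range n := by
    rw [Finset.mem_range]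
    by_contra h
    exact hex.choose_spec (hn i (not_lt.1 h))
  have h1 : a i * |(f hex.choose).1 i| ≤ F (f hex.choose) := by
    rw [hF _ n hn]
    exact Finset.single_le_sum (f := fun i => a i * |(f hex.choose).1 i|)
      (fun j _ => mul_nonneg (ha j) (abs_nonneg _)) hin
  have h2 : a i * |(f hex.choose).1 i| = i := by
    simp only [a, dif_pos hex]
    exact div_mul_cancel₀ _ (abs_pos.2 hex.choose_spec).ne'
  have h3 : F (f hex.choose) ≤ B := hB ⟨_, rfl⟩
  have h4 : (N : ℝ) ≤ i := by exact_mod_cast hi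
  linarith

/-- Two unit vectors that are not antipodal span a segment which avoids the origin. -/
theorem InfSphere.segment_ne_zero {u v : InfSphere} (h : u ≠ antipodal.toMap v)
    (t : stdSimplex ℝ (Fin 2)) : (fun i => t 0 * u.1 i + t 1 * v.1 i) ≠ 0 := by
  intro h0
  have e : ∀ i, t 0 * u.1 i = -(t 1 * v.1 i) := fun i => by
    have := congrFun h0 i
    simp only [Pi.zero_apply] at this
    linarith
  obtain ⟨n, hn⟩ := exists_bound_of_finite_support u.finite_support
  obtain ⟨m, hm⟩ := exists_bound_of_finite_support v.finite_support
  have hu := u.finsum_sq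
  have hv := v.finsum_sq
  rw [finsum_sq_eq (n := n + m) fun i hi => hn i (by omega)] at hu
  rw [finsum_sq_eq (n := n + m) fun i hi => hm i (by omega)] at hv
  -- Comparing the squared norms of `t 0 • u = -(t 1 • v)` forces both weights to be `1/2`, whence
  -- `u = -v`.
  have hsq : t 0 ^ 2 = t 1 ^ 2 := by
    rw [← mul_one (t 0 ^ 2), ← mul_one (t 1 ^ 2), ← hu]
    rw [Finset.mul_sum, hu, ← hv, Finset.mul_sum]
    refine Finset.sum_congr rfl fun i _ => ?_
    rw [← mul_pow, ← mul_pow, e, neg_sq]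
  have ht : t 0 = t 1 := by
    rwa [sq_eq_sq₀ (stdSimplex.zero_le t 0) (stdSimplex.zero_le t 1)] at hsq
  have hsum := stdSimplex.add_eq_one t
  have ht1 : t 1 = 1 / 2 := by linarith
  refine h (Subtype.ext (funext fun i => ?_))
  change u.1 i = -v.1 i
  have := e i
  rw [ht, ht1] at this
  linarith

/-! ### Self-maps of `S^∞` that separate supports. -/

/-- The sequence whose terms of parity `ε` are the terms of `v` and whose other terms are zero. -/
def spreadSeq (ε : ℕ) (v : ℕ → ℝ) : ℕ → ℝ := fun i => if i % 2 = ε then v (i / 2) else 0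

/-- Of the indices `2n` and `2n + 1`, exactly one carries `v n` and the other carries zero. -/
theorem sum_sq_spreadSeq {ε : ℕ} (hε : ε < 2) (v : ℕ → ℝ) (n : ℕ) :
    ∑ i ∈ Finset.range (2 * n), spreadSeq ε v i ^ 2 = ∑ i ∈ Finset.range n, v i ^ 2 := by
  induction n with
  | zero => rfl
  | succ n ih =>
    have h₁ : (2 * n + 1) / 2 = n := by omega
    rw [Nat.mul_succ, Finset.sum_range_succ, Finset.sum_range_succ, ih, Finset.sum_range_succ]
    interval_cases ε <;> simp [spreadSeq, h₁, Nat.add_mod]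

theorem spreadSeq_mem_finSphere {ε : ℕ} (hε : ε < 2) {n : ℕ} {v : ℕ → ℝ} (hv : v ∈ finSphere n) :
    spreadSeq ε v ∈ finSphere (2 * n) := by
  refine ⟨fun i hi => ?_, (sum_sq_spreadSeq hε v n).trans hv.2⟩
  unfold spreadSeq
  rw [hv.1 (i / 2) (by omega), ite_self]

/-- The `ℤ₂`-map of `S^∞` to itself that moves the coordinates to those of parity `ε`. -/
def InfSphere.spread (ε : ℕ) (hε : ε < 2) : EquivariantMap antipodal antipodal where
  toMap :=
    { toFun := fun v => ⟨spreadSeq ε v.1, v.2.elim fun _ h => ⟨_, spreadSeq_mem_finSphere hε h⟩⟩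
      continuous_toFun := by
        refine continuous_iSup_dom.2 fun n => continuous_coinduced_dom.2 ?_
        refine (InfSphere.continuous_incl (2 * n)).comp (f := fun v : finSphere n =>
          (⟨spreadSeq ε v.1, spreadSeq_mem_finSphere hε v.2⟩ : finSphere (2 * n))) ?_
        refine Continuous.subtype_mk (continuous_pi fun i => ?_) _
        unfold spreadSeq
        split_ifs
        · exact (continuous_apply _).comp continuous_subtype_val
        · exact continuous_const }
  equivariant v := Subtype.ext (funext fun i => by
    change spreadSeq ε (-v.1) i = -spreadSeq ε v.1 i
    unfold spreadSeq
    split_ifs <;> simp)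

/-- An equality would make each coordinate either zero or the negative of the coordinate at `i / 2`.
Descent to smaller indices ends at `i = 0`, where `v 0 = -v 0`, so `v` would vanish. -/
theorem InfSphere.ne_neg_spread (ε : ℕ) (hε : ε < 2) (v : InfSphere) :
    v ≠ antipodal.toMap ((InfSphere.spread ε hε).toMap v) := by
  intro h
  have h' : ∀ i, v.1 i = -spreadSeq ε v.1 i := congrFun (congrArg Subtype.val h)
  refine v.ne_zero (funext fun i => ?_)
  induction i using Nat.strong_induction_on with
  | _ i ih =>
    have hi := h' i
    unfold spreadSeq at hi
    rw [Pi.zero_apply]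
    split_ifs at hi
    · rcases Nat.eq_zero_or_pos i with rfl | hpos
      · simp only [Nat.zero_div] at hi
        linarith
      · rw [hi, ih (i / 2) (by omega)]
        simp
    · simpa using hi

/-- The two images have disjoint supports, so they could be antipodal only if both vanished. -/
theorem InfSphere.spread_ne_neg_spread (u v : InfSphere) :
    (InfSphere.spread 0 (by norm_num)).toMap u ≠
      antipodal.toMap ((InfSphere.spread 1 (by norm_num)).toMap v) := by
  intro h
  have h' : ∀ i, spreadSeq 0 u.1 i = -spreadSeq 1 v.1 i := congrFun (congrArg Subtype.val h)
  refine u.ne_zero (funext fun i => ?_)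
  simpa [spreadSeq] using h' (2 * i)

/-! ### Independence of the map to `S^∞` -/

/-- The cell is closed in a product of unit intervals, compact by Tychonoff even for infinite `V`
and `W`. Compactness confines the image of a cell in `S^∞` to a finite-dimensional sphere. -/
theorem HomCell.isCompact_carrier {V W : Type*} {T : LoopGraph V} {G : LoopGraph W}
    (η : HomCell T G) : IsCompact η.carrier := by
  have hK : IsCompact (Set.univ.pi fun _ : V => Set.univ.pi fun _ : W => Set.Icc (0 : ℝ) 1) :=
    isCompact_univ_pi fun _ => isCompact_univ_pi fun _ => isCompact_Icc
  have hc : ∀ x w, Continuous fun p : V → W → ℝ => p x w := fun x w =>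
    (continuous_apply w).comp (continuous_apply x)
  refine hK.of_isClosed_subset ?_ fun p hp x _ w _ => ⟨(hp x).1 w, ?_⟩
  · simp only [HomCell.carrier, Set.ofPred_forall, Set.ofPred_and]
    refine isClosed_iInter fun x => (isClosed_iInter fun w => ?_).inter
      ((isClosed_iInter fun w => isClosed_iInter fun _ => ?_).inter ?_)
    · exact isClosed_le continuous_const (hc x w)
    · exact isClosed_eq (hc x w) continuous_const
    · exact isClosed_eq (continuous_finsetSum _ fun w _ => hc x w) continuous_const
  · by_cases hw : w ∈ η.toFun x
    · rw [← (hp x).2.2]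
      exact Finset.single_le_sum (fun w _ => (hp x).1 w) hw
    · rw [(hp x).2.1 w hw]
      exact zero_le_one

theorem HomComplex.continuous_of_cells {V W Z : Type*} {T : LoopGraph V} {G : LoopGraph W}
    [TopologicalSpace Z] {f : HomComplex T G → Z}
    (h : ∀ η : HomCell T G, Continuous (f ∘ HomComplex.incl η)) : Continuous f :=
  continuous_iSup_dom.2 fun η => continuous_coinduced_dom.2 (h η)

theorem InfSphere.finite_support_segment (u v : InfSphere) (t : stdSimplex ℝ (Fin 2)) :
    (fun i => t 0 * u.1 i + t 1 * v.1 i).support.Finite := by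
  refine (u.finite_support.union v.finite_support).subset fun i hi => ?_
  by_contra h
  simp only [Set.mem_union, Function.mem_support, not_or, not_not] at h
  exact hi (by simp [h.1, h.2])

/-- The point with parameter `t` of the great circle arc between two points that are not
antipodal. -/
def InfSphere.arc (u v : InfSphere) (h : u ≠ antipodal.toMap v) (t : stdSimplex ℝ (Fin 2)) :
    InfSphere :=
  InfSphere.normalize _ (InfSphere.finite_support_segment u v t) (InfSphere.segment_ne_zero h t)

/-- Compactness of `K` puts both families in a single `ℝ^(m+n)`, where continuity can be checked
coordinatewise. -/
theorem InfSphere.continuous_arc {K : Type*} [TopologicalSpace K] [CompactSpace K]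
    {u v : K → InfSphere} (hu : Continuous u) (hv : Continuous v)
    (h : ∀ k, u k ≠ antipodal.toMap (v k)) :
    Continuous fun p : K × stdSimplex ℝ (Fin 2) => InfSphere.arc (u p.1) (v p.1) (h p.1) p.2 := by
  obtain ⟨m, hm⟩ := InfSphere.exists_bound_of_compact u hu
  obtain ⟨n, hn⟩ := InfSphere.exists_bound_of_compact v hv
  refine InfSphere.continuous_normalize (m + n) _ (fun i => ?_) (fun p i hi => ?_) _ _
  · have ht : ∀ j, Continuous fun p : K × stdSimplex ℝ (Fin 2) => p.2 j := fun j =>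
      (continuous_apply j).comp (continuous_subtype_val.comp continuous_snd)
    exact ((ht 0).mul (((InfSphere.continuous_coord i).comp hu).comp continuous_fst)).add
      ((ht 1).mul (((InfSphere.continuous_coord i).comp hv).comp continuous_fst))
  · simp [hm p.1 i (by omega), hn p.1 i (by omega)]

/-- The arcs from `w x` to `w' x` form a homotopy, equivariant because negating both ends negates
the arc. -/
theorem pullback_onOrbits_eq_of_not_antipodal {V W : Type*} {T : LoopGraph V} {G : LoopGraph W}
    {τ : FreeInvolution (HomComplex T G)} (w w' : EquivariantMap τ antipodal)
    (h : ∀ x, w.toMap x ≠ antipodal.toMap (w'.toMap x)) (z : Cohomology 1 (OrbitSpace antipodal)) :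
    pullback 1 w.onOrbits z = pullback 1 w'.onOrbits z := by
  have hcell : ∀ η : HomCell T G, Continuous fun p : η.carrier × stdSimplex ℝ (Fin 2) =>
      InfSphere.arc _ _ (h (HomComplex.incl η p.1)) p.2 := fun η => by
    have := isCompact_iff_compactSpace.1 η.isCompact_carrier
    exact InfSphere.continuous_arc
      (w.toMap.continuous.comp (HomComplex.continuous_incl η))
      (w'.toMap.continuous.comp (HomComplex.continuous_incl η))
      (fun p => h (HomComplex.incl η p))
  have harc : ∀ x, Continuous (InfSphere.arc _ _ (h x)) := by
    rintro ⟨p, η, hp⟩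
    exact (hcell η).comp (Continuous.prodMk_right (⟨p, hp⟩ : η.carrier))
  -- Currying leaves the complex alone as domain, so continuity can be tested on closed cells
  -- without knowing the weak topology of its product with an interval.
  let H : C(HomComplex T G, C(stdSimplex ℝ (Fin 2), InfSphere)) :=
    ⟨fun x => ⟨InfSphere.arc _ _ (h x), harc x⟩,
      HomComplex.continuous_of_cells fun η =>
        ContinuousMap.continuous_of_continuous_uncurry _ (hcell η)⟩
  refine pullback_onOrbits_eq w w' H (fun x t => ?_) (fun x => ?_) (fun x => ?_) z
  · refine InfSphere.normalize_neg (InfSphere.finite_support_segment _ _ t)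
      (InfSphere.segment_ne_zero (h _) t) (InfSphere.finite_support_segment _ _ t)
      (InfSphere.segment_ne_zero (h _) t) (funext fun i => ?_)
    rw [w.equivariant, w'.equivariant]
    change t 0 * (-(w.toMap x).1 i) + t 1 * (-(w'.toMap x).1 i) =
      -(t 0 * (w.toMap x).1 i + t 1 * (w'.toMap x).1 i)
    ring
  · exact InfSphere.normalize_eq (InfSphere.finite_support_segment _ _ _)
      (InfSphere.segment_ne_zero (h x) _) _ (funext fun i => by simp)
  · exact InfSphere.normalize_eq (InfSphere.finite_support_segment _ _ _)
      (InfSphere.segment_ne_zero (h x) _) _ (funext fun i => by simp)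

/-- Composition of `ℤ₂`-maps. -/
def EquivariantMap.comp {X Y Z : Type*} [TopologicalSpace X] [TopologicalSpace Y]
    [TopologicalSpace Z] {τ : FreeInvolution X} {ρ : FreeInvolution Y} {σ : FreeInvolution Z}
    (g : EquivariantMap ρ σ) (f : EquivariantMap τ ρ) : EquivariantMap τ σ where
  toMap := g.toMap.comp f.toMap
  equivariant x := by
    rw [ContinuousMap.comp_apply, f.equivariant, g.equivariant, ContinuousMap.comp_apply]

theorem EquivariantMap.onOrbits_comp {X Y Z : Type*} [TopologicalSpace X] [TopologicalSpace Y]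
    [TopologicalSpace Z] {τ : FreeInvolution X} {ρ : FreeInvolution Y} {σ : FreeInvolution Z}
    (g : EquivariantMap ρ σ) (f : EquivariantMap τ ρ) :
    (g.comp f).onOrbits = g.onOrbits.comp f.onOrbits := by
  ext1 x
  induction x using Quot.ind with
  | mk x => rfl

/-- Any two `ℤ₂`-maps to `S^∞` agree on `H¹` of the orbit spaces. -/
theorem pullback_onOrbits_unique {V W : Type*} {T : LoopGraph V} {G : LoopGraph W}
    {τ : FreeInvolution (HomComplex T G)} (w w' : EquivariantMap τ antipodal)
    (z : Cohomology 1 (OrbitSpace antipodal)) :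
    pullback 1 w.onOrbits z = pullback 1 w'.onOrbits z :=
  -- The values of `w` and `w'` may be antipodal somewhere, which rules out a direct arc. Moving `w`
  -- to even and `w'` to odd coordinates removes the obstruction.
  (pullback_onOrbits_eq_of_not_antipodal w ((InfSphere.spread 0 (by norm_num)).comp w)
    (fun x => InfSphere.ne_neg_spread 0 (by norm_num) (w.toMap x)) z).trans <|
  (pullback_onOrbits_eq_of_not_antipodal ((InfSphere.spread 0 (by norm_num)).comp w)
    ((InfSphere.spread 1 (by norm_num)).comp w')
    (fun x => InfSphere.spread_ne_neg_spread (w.toMap x) (w'.toMap x)) z).trans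
  (pullback_onOrbits_eq_of_not_antipodal w' ((InfSphere.spread 1 (by norm_num)).comp w')
    (fun x => InfSphere.ne_neg_spread 1 (by norm_num) (w'.toMap x)) z).symm

/-- This replaces the map chosen in the definition by any convenient one, in particular by a
composite through another complex. -/
theorem stiefelWhitney_eq {V W : Type*} {T : LoopGraph V} {G : LoopGraph W}
    {τ : FreeInvolution (HomComplex T G)} (w : EquivariantMap τ antipodal) :
    stiefelWhitney τ = pullback 1 w.onOrbits generatorRP := by
  rw [stiefelWhitney, dif_pos ⟨w⟩]
  exact pullback_onOrbits_unique _ w _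

/-! ### The map of `Hom` complexes which a colouring induces -/

/-- The cell of `Hom(T, H)` that contains the image of a cell of `Hom(T, G)` under a graph
homomorphism `G → H`. -/
def HomCell.map {V W U : Type*} [DecidableEq U] {T : LoopGraph V} {G : LoopGraph W}
    {H : LoopGraph U} (c : W → U) (hc : ∀ u v, G.Adj u v → H.Adj (c u) (c v)) (η : HomCell T G) :
    HomCell T H where
  toFun x := (η.toFun x).image c
  nonempty x := (η.nonempty x).image c
  finite := η.finite.subset fun _ hx => lt_of_lt_of_le hx Finset.card_image_le
  adj x y h u hu v hv := by
    obtain ⟨u', hu', rfl⟩ := Finset.mem_image.1 hu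
    obtain ⟨v', hv', rfl⟩ := Finset.mem_image.1 hv
    exact hc _ _ (η.adj x y h u' hu' v' hv')

open Classical in
/-- The image of a weight function under a map of the vertices. -/
def pushWeight {W U : Type*} (c : W → U) (p : W → ℝ) (u : U) : ℝ :=
  ∑ᶠ w, if c w = u then p w else 0

-- The fibres of `c` may be infinite. The `finsum` keeps the pushforward independent of the cell,
-- while any finite set carrying the weights computes it.
open Classical in
theorem pushWeight_eq {W U : Type*} (c : W → U) {s : Finset W} {p : W → ℝ}
    (hp : ∀ w, w ∉ s → p w = 0) (u : U) :
    pushWeight c p u = ∑ w ∈ s, if c w = u then p w else 0 :=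
  finsum_eq_sum_of_support_subset _ fun w hw => by
    by_contra h
    exact hw (by simp [hp w h])

open Classical in
theorem pushWeight_mem_carrier {V W U : Type*} {T : LoopGraph V} {G : LoopGraph W}
    {H : LoopGraph U} (c : W → U) (hc : ∀ u v, G.Adj u v → H.Adj (c u) (c v)) {η : HomCell T G}
    {p : V → W → ℝ} (hp : p ∈ η.carrier) :
    (fun x => pushWeight c (p x)) ∈ (η.map c hc).carrier := by
  intro x
  obtain ⟨h₀, h₁, h₂⟩ := hp x
  refine ⟨fun u => ?_, fun u hu => ?_, ?_⟩
  · change 0 ≤ pushWeight c (p x) u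
    rw [pushWeight_eq c h₁]
    exact Finset.sum_nonneg fun w _ => by split_ifs; exacts [h₀ w, le_rfl]
  · change pushWeight c (p x) u = 0
    rw [pushWeight_eq c h₁]
    refine Finset.sum_eq_zero fun w hw => if_neg ?_
    rintro rfl
    exact hu (Finset.mem_image_of_mem c hw)
  · simp only [pushWeight_eq c h₁]
    -- After the exchange of sums, each `w` gives its weight to exactly one vertex, `c w`, so the
    -- total stays `1`.
    rw [Finset.sum_comm, ← h₂]
    refine Finset.sum_congr rfl fun w hw => ?_
    rw [Finset.sum_ite_eq, if_pos]
    exact Finset.mem_image_of_mem c hw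

open Classical in
/-- The `ℤ₂`-map `Hom(T, G) → Hom(T, H)` that a graph homomorphism `G → H` induces. -/
def homComplexMap {V W U : Type*} {T : LoopGraph V} (γ : T.Z2Action) (hγ : γ.FlipsEdge)
    {G : SimpleGraph W} {H : SimpleGraph U} (c : G →g H) :
    EquivariantMap (homInvolution γ hγ G) (homInvolution γ hγ H) where
  toMap :=
    { toFun := fun p => ⟨fun x => pushWeight c (p.1 x), p.2.elim fun η h =>
        ⟨η.map (H := .ofSimple H) c fun _ _ h => c.map_adj h, pushWeight_mem_carrier (H := .ofSimple H) c (fun _ _ h => c.map_adj h) h⟩⟩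
      continuous_toFun := HomComplex.continuous_of_cells fun η => by
        refine (HomComplex.continuous_incl (HomCell.map (H := .ofSimple H) c (fun _ _ h => c.map_adj h) η)).comp
          (f := fun p : η.carrier => ⟨_, pushWeight_mem_carrier (H := .ofSimple H) c (fun _ _ h => c.map_adj h) p.2⟩) ?_
        refine Continuous.subtype_mk (continuous_pi fun x => continuous_pi fun u => ?_) _
        simp only [fun p : η.carrier => pushWeight_eq c (p.2 x).2.1 u]
        refine continuous_finsetSum _ fun w _ => ?_
        split_ifs
        · exact (continuous_apply w).comp ((continuous_apply x).comp continuous_subtype_val)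
        · exact continuous_const }
  -- The involution acts on the index in `V` and the pushforward on the index in `W`.
  equivariant _ := rfl

/-! ### A `ℤ₂`-map from `Hom(T, G)` to a sphere, for a finite graph `G` -/

/-- The difference of the coordinates at the ends of an edge, as a sequence. -/
def edgeDiff {V : Type*} {m : ℕ} (a b : V) (p : V → Fin m → ℝ) : ℕ → ℝ := fun i =>
  if h : i < m then p a ⟨i, h⟩ - p b ⟨i, h⟩ else 0

theorem edgeDiff_eq_zero {V : Type*} {m : ℕ} (a b : V) (p : V → Fin m → ℝ) (i : ℕ) (hi : m ≤ i) :
    edgeDiff a b p i = 0 := dif_neg (not_lt.2 hi)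

theorem edgeDiff_finite {V : Type*} {m : ℕ} (a b : V) (p : V → Fin m → ℝ) :
    (edgeDiff a b p).support.Finite :=
  (Set.finite_lt_nat m).subset fun i hi => by
    by_contra h
    exact hi (edgeDiff_eq_zero a b p i (not_lt.1 h))

/-- The weights at adjacent vertices have disjoint supports, since a common vertex of `G` would
carry a loop; no cancellation can occur. -/
theorem edgeDiff_ne_zero {V : Type*} {T : LoopGraph V} {m : ℕ} {G : SimpleGraph (Fin m)} {a b : V}
    (hab : T.Adj a b) (p : HomComplex T (LoopGraph.ofSimple G)) : edgeDiff a b p.1 ≠ 0 := by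
  obtain ⟨p, η, hp⟩ := p
  intro h
  obtain ⟨w, hw, hne⟩ : ∃ w ∈ η.toFun a, p a w ≠ 0 := by
    apply Finset.exists_ne_zero_of_sum_ne_zero
    rw [(hp a).2.2]
    exact one_ne_zero
  have hw' : w ∉ η.toFun b := fun hb => G.irrefl (η.adj _ _ hab w hw w hb)
  have h₀ := congrFun h w
  simp only [edgeDiff, dif_pos w.2, Fin.eta, (hp b).2.1 w hw', sub_zero, Pi.zero_apply] at h₀
  exact hne h₀

/-- Since `γ` interchanges `a` and `b`, the vector `p a - p b` changes sign under the involution. It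
is a nonzero vector of `ℝ^m`, so normalising it gives the map. -/
theorem nonempty_equivariantMap_antipodal {V : Type*} {T : LoopGraph V} (γ : T.Z2Action)
    (hγ : γ.FlipsEdge) {m : ℕ} (G : SimpleGraph (Fin m)) :
    Nonempty (EquivariantMap (homInvolution γ hγ G) antipodal) := by
  obtain ⟨a, b, hab, h₁, h₂⟩ := id hγ
  refine ⟨⟨⟨fun p => InfSphere.normalize _ (edgeDiff_finite a b p.1) (edgeDiff_ne_zero hab p),
    HomComplex.continuous_of_cells fun η => ?_⟩, fun p => ?_⟩⟩
  · refine InfSphere.continuous_normalize m (fun p : η.carrier => edgeDiff a b p.1) (fun i => ?_)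
      (fun p i hi => edgeDiff_eq_zero a b p.1 i hi) (fun p => edgeDiff_finite a b p.1)
      (fun p => edgeDiff_ne_zero hab (HomComplex.incl η p))
    unfold edgeDiff
    split_ifs with h
    · have hc : ∀ x, Continuous fun p : η.carrier => p.1 x ⟨i, h⟩ := fun x =>
        (continuous_apply _).comp ((continuous_apply x).comp continuous_subtype_val)
      exact (hc a).sub (hc b)
    · exact continuous_const
  · refine InfSphere.normalize_neg (edgeDiff_finite a b _) (edgeDiff_ne_zero hab _)
      (edgeDiff_finite a b _) (edgeDiff_ne_zero hab _) (funext fun i => ?_)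
    change edgeDiff a b (fun x => p.1 (γ.toFun x)) i = -edgeDiff a b p.1 i
    unfold edgeDiff
    split_ifs
    · simp only [h₁, h₂, neg_sub]
    · exact neg_zero.symm

end HomSW

end

/-! ### The colouring argument. -/

theorem mainTheorem2 {V W : Type*} (T : HomSW.LoopGraph V) (γ : T.Z2Action) (hγ : γ.FlipsEdge)
    (G : SimpleGraph W) (k m : ℕ) (hm : 1 ≤ m)
    (hG : HomSW.cupPow (HomSW.stiefelWhitney (HomSW.homInvolution γ hγ G)) k ≠ 0)
    (hK : HomSW.cupPow
      (HomSW.stiefelWhitney (HomSW.homInvolution γ hγ (⊤ : SimpleGraph (Fin m)))) k = 0) :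
    ((m + 1 : ℕ) : ℕ∞) ≤ G.chromaticNumber := by
  by_contra h
  have hcol : G.Colorable m := by
    rw [← SimpleGraph.chromaticNumber_le_iff_colorable]
    rw [not_le, Nat.cast_add, Nat.cast_one] at h
    exact Order.le_of_lt_add_one h
  obtain ⟨c⟩ := hcol
  obtain ⟨w⟩ := HomSW.nonempty_equivariantMap_antipodal γ hγ (⊤ : SimpleGraph (Fin m))
  let f := HomSW.homComplexMap γ hγ c
  refine hG ?_
  -- The class of `Hom(T, G)` is computed with the map that factors through `Hom(T, K_m)`; this also
  -- settles the existence of a `ℤ₂`-map for the possibly infinite `G`.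
  rw [HomSW.stiefelWhitney_eq (w.comp f), HomSW.EquivariantMap.onOrbits_comp,
    ← HomSW.pullback_comp, ← HomSW.stiefelWhitney_eq w, ← HomSW.pullback_cupPow, hK, map_zero]
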